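/- Let $X$ be a (real) Banach lattice and let $\mathcal S$ be a semigroup (under composition) of positive bounded linear operators on $X$ which is $\mathbb R_+$-closed, i.e. closed in the operator norm and closed under multiplication by positive scalars, and ideal irreducible, i.e. no closed ideal of the Banach lattice $X$ other than $\{0\}$ and $X$ is invariant under all members of $\mathcal S$. Suppose that the minimal rank $r$ of the non-zero members of $\mathcal S$ is finite (in particular, $\mathcal S$ contains a non-zero operator of finite rank). Then for every $S\in\mathcal S$ which has rank $r$ or is zero there exist $P,Q\in\mathcal S$ of rank $r$ with $P^2=P$, $Q^2=Q$ and $PS=SQ=S$. -/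

import Mathlib

/-- A real Banach lattice: a Banach space and vector lattice whose norm is a lattice norm. -/
class BanachLattice (X : Type*) [NormedAddCommGroup X] [NormedSpace ℝ X] [Lattice X] : Prop
    extends CompleteSpace X, IsOrderedAddMonoid X, IsOrderedModule ℝ X, HasSolidNorm X

namespace OperatorSemigroup

variable {X : Type*} [NormedAddCommGroup X] [NormedSpace ℝ X]

/-- The rank of a bounded operator, with value `⊤` when its range is infinite-dimensional. -/
noncomputable def opRank (T : X →L[ℝ] X) : ℕ∞ :=
  Cardinal.toENat (LinearMap.rank (T : X →ₗ[ℝ] X))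

/-- The minimal rank of the non-zero members of `𝒮`; it is `⊤` if `𝒮` contains no non-zero
operator of finite rank. -/
noncomputable def minrank (𝒮 : Subsemigroup (X →L[ℝ] X)) : ℕ∞ :=
  sInf (opRank '' {T | T ∈ 𝒮 ∧ T ≠ 0})

/-- Norm closed and closed under multiplication by positive scalars. -/
def IsRPlusClosed (𝒮 : Subsemigroup (X →L[ℝ] X)) : Prop :=
  IsClosed (𝒮 : Set (X →L[ℝ] X)) ∧ ∀ c : ℝ, 0 < c → ∀ T ∈ 𝒮, c • T ∈ 𝒮

/-- The members of `𝒮` of rank `r`, together with the zero operator. -/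
def rankPart (𝒮 : Subsemigroup (X →L[ℝ] X)) (r : ℕ) : Set (X →L[ℝ] X) :=
  {T | T ∈ 𝒮 ∧ (opRank T = r ∨ T = 0)}

/-- The projections of rank `r` in `𝒮`. -/
def rankProjections (𝒮 : Subsemigroup (X →L[ℝ] X)) (r : ℕ) : Set (X →L[ℝ] X) :=
  {P | P ∈ 𝒮 ∧ P * P = P ∧ opRank P = r}

variable [Lattice X]

/-- A positive operator maps the positive cone into itself. -/
def IsPositiveOp (T : X →L[ℝ] X) : Prop :=
  ∀ x : X, 0 ≤ x → 0 ≤ T x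

/-- A (lattice) ideal: a linear subspace `J` such that `x ∈ J` and `|y| ≤ |x|` imply `y ∈ J`. -/
def IsLatticeIdeal (J : Submodule ℝ X) : Prop :=
  ∀ x ∈ J, ∀ y : X, |y| ≤ |x| → y ∈ J

/-- No closed ideal other than `{0}` and the whole space is invariant under every member
of `𝒮`. -/
def IsIdealIrreducible (𝒮 : Subsemigroup (X →L[ℝ] X)) : Prop :=
  ∀ J : Submodule ℝ X, IsLatticeIdeal J → IsClosed (J : Set X) →
    (∀ T ∈ 𝒮, ∀ x ∈ J, T x ∈ J) → J = ⊥ ∨ J = ⊤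

end OperatorSemigroup

open Filter Topology

namespace OperatorSemigroup

/-! ### Minimal rank, and projections from powers of one operator -/

section Rank

variable {X : Type*} [NormedAddCommGroup X] [NormedSpace ℝ X]

/-! For `S ≠ 0`, irreducibility yields `A ∈ 𝒮` with `S * A * S ≠ 0` (`exists_mul_mul_ne_zero`). By
minimality of `r` this product has the same range as `S`, so `S * A` permutes that
finite-dimensional range, and neither `S * A` nor `A * S` squares to zero. Scaled powers of such an
operator accumulate at a projection with its range and kernel
(`exists_projection_of_mul_self_ne_zero`); those from `S * A` and `A * S` serve as `P` and `Q`. -/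

theorem opRank_mul_le_left (A B : X →L[ℝ] X) : opRank (A * B) ≤ opRank A :=
  Cardinal.toENat.monotone' (LinearMap.rank_comp_le_left (B : X →ₗ[ℝ] X) (A : X →ₗ[ℝ] X))

theorem opRank_mul_le_right (A B : X →L[ℝ] X) : opRank (A * B) ≤ opRank B :=
  Cardinal.toENat.monotone' (LinearMap.rank_comp_le_right (B : X →ₗ[ℝ] X) (A : X →ₗ[ℝ] X))

theorem finiteDimensional_range_of_opRank_eq {T : X →L[ℝ] X} {r : ℕ} (h : opRank T = r) :
    FiniteDimensional ℝ (LinearMap.range (T : X →ₗ[ℝ] X)) := by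
  have h' : Module.rank ℝ (LinearMap.range (T : X →ₗ[ℝ] X)) = r := Cardinal.toENat_eq_natCast.1 h
  exact Module.rank_lt_aleph0_iff.1 (h' ▸ Cardinal.natCast_lt_aleph0)

theorem finrank_range_of_opRank_eq {T : X →L[ℝ] X} {r : ℕ} (h : opRank T = r) :
    Module.finrank ℝ (LinearMap.range (T : X →ₗ[ℝ] X)) = r :=
  Module.finrank_eq_of_rank_eq (Cardinal.toENat_eq_natCast.1 h)

theorem le_opRank {𝒮 : Subsemigroup (X →L[ℝ] X)} {r : ℕ} (hr : minrank 𝒮 = r)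
    {T : X →L[ℝ] X} (hT : T ∈ 𝒮) (h0 : T ≠ 0) : (r : ℕ∞) ≤ opRank T :=
  hr ▸ sInf_le ⟨T, ⟨hT, h0⟩, rfl⟩

theorem exists_opRank_eq {𝒮 : Subsemigroup (X →L[ℝ] X)} {r : ℕ} (hr : minrank 𝒮 = r) :
    ∃ T ∈ 𝒮, T ≠ 0 ∧ opRank T = r := by
  have hne : (opRank '' {T | T ∈ 𝒮 ∧ T ≠ 0}).Nonempty := by
    by_contra h
    rw [Set.not_nonempty_iff_eq_empty] at h
    simp [minrank, h] at hr
  obtain ⟨T, ⟨hT, h0⟩, h⟩ := csInf_mem hne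
  exact ⟨T, hT, h0, h.trans hr⟩

theorem range_eq_of_range_le {A S : X →L[ℝ] X} {r : ℕ} (hA : opRank A = r) (hS : opRank S = r)
    (h : LinearMap.range (A : X →ₗ[ℝ] X) ≤ LinearMap.range (S : X →ₗ[ℝ] X)) :
    LinearMap.range (A : X →ₗ[ℝ] X) = LinearMap.range (S : X →ₗ[ℝ] X) := by
  have := finiteDimensional_range_of_opRank_eq hS
  exact Submodule.eq_of_le_of_finrank_eq h
    ((finrank_range_of_opRank_eq hA).trans (finrank_range_of_opRank_eq hS).symm)

theorem range_mul_le (A B : X →L[ℝ] X) :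
    LinearMap.range ((A * B : X →L[ℝ] X) : X →ₗ[ℝ] X) ≤ LinearMap.range (A : X →ₗ[ℝ] X) :=
  LinearMap.range_comp_le_range (B : X →ₗ[ℝ] X) (A : X →ₗ[ℝ] X)

/-- If the normalized powers of an element `M` of a finite-dimensional normed algebra only
accumulate at units, then suitable multiples of suitable powers of `M` converge to `M⁻¹`. -/
theorem exists_tendsto_smul_pow_inverse {R : Type*} [NormedRing R] [NormedAlgebra ℝ R]
    [FiniteDimensional ℝ R] {M : R} (hM : IsUnit M) [Nontrivial R]
    (hlim : ∀ L : R, L ≠ 0 → L ∈ closure {N | ∃ c : ℝ, 0 < c ∧ ∃ n : ℕ, N = c • M ^ n} →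
      IsUnit L) :
    Ring.inverse M ∈ closure {N | ∃ c : ℝ, 0 < c ∧ ∃ n : ℕ, N = c • M ^ n} := by
  have : ProperSpace R := FiniteDimensional.proper ℝ R
  have : CompleteSpace R := FiniteDimensional.complete ℝ R
  have hne : ∀ n, 0 < ‖M ^ n‖ := fun n => norm_pos_iff.2 (hM.pow n).ne_zero
  set u : ℕ → R := fun n => ‖M ^ n‖⁻¹ • M ^ n with hu
  have hu_unit : ∀ n, IsUnit (u n) := fun n =>
    (hM.pow n).smul (Units.mk0 (‖M ^ n‖⁻¹) (inv_pos.2 (hne n)).ne')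
  have hu_norm : ∀ n, u n ∈ Metric.sphere (0 : R) 1 := fun n => by
    simp [hu, norm_smul, (hne n).ne']
  obtain ⟨L, hL, φ, hφ, hlimL⟩ := (isCompact_sphere (0 : R) 1).tendsto_subseq hu_norm
  have hL0 : L ≠ 0 := by
    rintro rfl
    simp at hL
  have hLu : IsUnit L := hlim L hL0 (mem_closure_of_tendsto hlimL
    (Eventually.of_forall fun k => ⟨_, inv_pos.2 (hne _), _, rfl⟩))
  have h1 : Tendsto (fun k => Ring.inverse (u (φ k))) atTop (𝓝 (Ring.inverse L)) := by
    obtain ⟨L', rfl⟩ := hLu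
    exact (NormedRing.inverse_continuousAt L').tendsto.comp hlimL
  have h2 : Tendsto (fun k => Ring.inverse M * (Ring.inverse (u (φ k)) * u (φ (k + 1)))) atTop
      (𝓝 (Ring.inverse M)) := by
    have := (h1.mul (hlimL.comp (tendsto_add_atTop_nat 1))).const_mul (Ring.inverse M)
    simpa [Ring.inverse_mul_cancel L hLu] using this
  refine mem_closure_of_tendsto h2 (Eventually.of_forall fun k => ?_)
  -- Here `φ (k + 1) = φ k + m + 1`; the extra factor `M` is cancelled by `Ring.inverse M`, leaving
  -- a positive multiple of `M ^ m`.
  obtain ⟨m, hm⟩ := Nat.exists_eq_add_of_lt (hφ (Nat.lt_succ_self k))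
  refine ⟨‖M ^ φ k‖ * ‖M ^ φ (k + 1)‖⁻¹, mul_pos (hne _) (inv_pos.2 (hne _)), m, ?_⟩
  have hk : u (φ (k + 1)) = u (φ k) * (M *
      ((‖M ^ φ k‖ * ‖M ^ φ (k + 1)‖⁻¹) • M ^ m)) := by
    have e : M ^ φ (k + 1) = M ^ φ k * (M * M ^ m) := by
      rw [← pow_succ', ← pow_add, ← add_assoc, ← hm]
    simp only [hu, mul_smul_comm, smul_mul_assoc, smul_smul, ← e]
    congr 1
    have := (hne (φ k)).ne'
    field_simp
  rw [hk, Ring.inverse_mul_cancel_left _ _ (hu_unit _), Ring.inverse_mul_cancel_left _ _ hM]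

/-- A non-nilpotent member `T` of minimal rank generates a projection with the same range and
kernel as `T`. -/
theorem exists_projection_of_mul_self_ne_zero {𝒮 : Subsemigroup (X →L[ℝ] X)}
    (hclosed : IsRPlusClosed 𝒮) {r : ℕ} (hr : minrank 𝒮 = r) {T : X →L[ℝ] X} (hT : T ∈ 𝒮)
    (hTr : opRank T = r) (hTT : T * T ≠ 0) :
    ∃ P ∈ rankProjections 𝒮 r, P * T = T ∧ T * P = T := by
  have hT0 : T ≠ 0 := fun h => hTT (by simp [h])
  set V := LinearMap.range (T : X →ₗ[ℝ] X)
  have hfin : FiniteDimensional ℝ V := finiteDimensional_range_of_opRank_eq hTr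
  have : CompleteSpace V := FiniteDimensional.complete ℝ V
  set T' : X →L[ℝ] V := T.codRestrict V (fun x => ⟨x, rfl⟩)
  have hT'_surj : Function.Surjective T' := by
    rintro ⟨_, x, rfl⟩
    exact ⟨x, rfl⟩
  set M : V →L[ℝ] V := T'.comp V.subtypeL
  -- `Φ` transports the problem to `V`, where `Φ (M ^ n)` is `T ^ (n + 1)` and `Φ N` is idempotent
  -- once `N * M * N = N`, as for `N = M⁻¹`.
  set Φ : (V →L[ℝ] V) → (X →L[ℝ] X) := fun N => V.subtypeL.comp (N.comp T') with hΦ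
  have hΦ_cont : Continuous Φ := by fun_prop
  have hΦ_mul : ∀ N N', Φ N * Φ N' = Φ (N * M * N') := fun N N' => rfl
  have hΦ_one : Φ 1 = T := rfl
  have hΦ_inj : ∀ N N', Φ N = Φ N' → N = N' := by
    intro N N' h
    ext v
    obtain ⟨x, rfl⟩ := hT'_surj v
    exact congrArg (fun A : X →L[ℝ] X => A x) h
  have hΦ_pow : ∀ n : ℕ, Φ (M ^ n) ∈ 𝒮 := by
    intro n
    induction n with
    | zero => exact hT
    | succ n ih =>
      have := 𝒮.mul_mem ih hT
      rwa [← hΦ_one, hΦ_mul, mul_one, ← pow_succ] at this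
  have hΦ_closure : ∀ L ∈ closure {N | ∃ c : ℝ, 0 < c ∧ ∃ n : ℕ, N = c • M ^ n}, Φ L ∈ 𝒮 := by
    intro L hL
    have hsub : {N | ∃ c : ℝ, 0 < c ∧ ∃ n : ℕ, N = c • M ^ n} ⊆ Φ ⁻¹' (𝒮 : Set (X →L[ℝ] X)) := by
      rintro _ ⟨c, hc, n, rfl⟩
      have e : Φ (c • M ^ n) = c • Φ (M ^ n) := by
        ext x
        simp [hΦ]
      change Φ (c • M ^ n) ∈ 𝒮
      rw [e]
      exact hclosed.2 c hc _ (hΦ_pow n)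
    exact closure_minimal hsub (hclosed.1.preimage hΦ_cont) hL
  have hrange : ∀ N, LinearMap.range (Φ N : X →ₗ[ℝ] X) ≤ V := by
    rintro N _ ⟨x, rfl⟩
    exact (N (T' x)).2
  have hrank : ∀ N, Φ N ∈ 𝒮 → N ≠ 0 → opRank (Φ N) = r := by
    intro N hN h0
    refine le_antisymm ?_ (le_opRank hr hN fun h => h0 (hΦ_inj _ _ (h.trans (by ext; simp [hΦ]))))
    exact hTr ▸ Cardinal.toENat.monotone' (Submodule.rank_mono (hrange N))
  -- Minimality of `r` enters here: a singular non-zero `N` would give a non-zero member of smaller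
  -- rank.
  have hunit : ∀ N, Φ N ∈ 𝒮 → N ≠ 0 → IsUnit N := by
    intro N hN h0
    have hsurj : Function.Surjective N := by
      intro v
      have hv : (v : X) ∈ LinearMap.range (Φ N : X →ₗ[ℝ] X) := by
        rw [range_eq_of_range_le (hrank N hN h0) hTr (hrange N)]
        exact v.2
      obtain ⟨x, hx⟩ := hv
      exact ⟨T' x, Subtype.ext hx⟩
    have hinj : Function.Injective N :=
      (LinearMap.injective_iff_surjective (f := (N : V →ₗ[ℝ] V))).2 hsurj
    rw [ContinuousLinearMap.isUnit_iff_bijective]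
    exact ⟨hinj, hsurj⟩
  have hM0 : M ≠ 0 := by
    intro h
    refine hTT ?_
    rw [← hΦ_one, hΦ_mul, h]
    ext
    simp [hΦ]
  have hMu : IsUnit M := hunit M (by simpa using hΦ_pow 1) hM0
  have : Nontrivial (V →L[ℝ] V) := ⟨M, 0, hM0⟩
  have hP := hΦ_closure _ (exists_tendsto_smul_pow_inverse hMu
    fun L hL0 hL => hunit L (hΦ_closure L hL) hL0)
  have hinv0 : Ring.inverse M ≠ 0 := hMu.ringInverse.ne_zero
  refine ⟨Φ (Ring.inverse M), ⟨hP, ?_, hrank _ hP hinv0⟩, ?_, ?_⟩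
  · rw [hΦ_mul, Ring.inverse_mul_cancel M hMu, one_mul]
  · nth_rw 1 [← hΦ_one]
    rw [hΦ_mul, Ring.inverse_mul_cancel M hMu, one_mul, hΦ_one]
  · nth_rw 1 [← hΦ_one]
    rw [hΦ_mul, one_mul, Ring.mul_inverse_cancel M hMu, hΦ_one]

end Rank

/-! ### Positivity and ideal irreducibility -/

section Irreducible

variable {X : Type*} [NormedAddCommGroup X] [NormedSpace ℝ X] [Lattice X]

theorem IsPositiveOp.mul {S T : X →L[ℝ] X} (hS : IsPositiveOp S) (hT : IsPositiveOp T) :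
    IsPositiveOp (S * T) :=
  fun x hx => hS _ (hT x hx)

variable [BanachLattice X]

theorem IsPositiveOp.monotone {T : X →L[ℝ] X} (hT : IsPositiveOp T) : Monotone T := by
  intro x y hxy
  have := hT (y - x) (sub_nonneg.2 hxy)
  rwa [map_sub, sub_nonneg] at this

theorem IsPositiveOp.abs_apply_le {T : X →L[ℝ] X} (hT : IsPositiveOp T) (x : X) :
    |T x| ≤ T |x| :=
  abs_le'.2 ⟨hT.monotone (le_abs_self x), by
    rw [← map_neg]
    exact hT.monotone (neg_le_abs x)⟩

theorem IsPositiveOp.apply_abs_eq_zero_of_le {T : X →L[ℝ] X} (hT : IsPositiveOp T) {x y : X}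
    (h : |y| ≤ x) (hx : T x = 0) : T |y| = 0 :=
  le_antisymm (hx ▸ hT.monotone h) (hT _ (abs_nonneg y))

/-- The absolute kernel of a positive operator. -/
def absKer (T : X →L[ℝ] X) (hT : IsPositiveOp T) : Submodule ℝ X where
  carrier := {x | T |x| = 0}
  zero_mem' := by simp
  add_mem' {x y} hx hy := hT.apply_abs_eq_zero_of_le (abs_add_le x y) (by
    rw [map_add, show T |x| = 0 from hx, show T |y| = 0 from hy, add_zero])
  smul_mem' c x hx := by
    have h : |c • x| ≤ |c| • |x| := by
      refine abs_le'.2 ⟨?_, ?_⟩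
      · rcases le_total 0 c with hc | hc
        · rw [abs_of_nonneg hc]
          exact smul_le_smul_of_nonneg_left (le_abs_self x) hc
        · rw [abs_of_nonpos hc, ← neg_smul_neg]
          exact smul_le_smul_of_nonneg_left (neg_le_abs x) (neg_nonneg.2 hc)
      · rcases le_total 0 c with hc | hc
        · rw [abs_of_nonneg hc, ← smul_neg]
          exact smul_le_smul_of_nonneg_left (neg_le_abs x) hc
        · rw [abs_of_nonpos hc, ← neg_smul]
          exact smul_le_smul_of_nonneg_left (le_abs_self x) (neg_nonneg.2 hc)
    exact hT.apply_abs_eq_zero_of_le h (by rw [map_smul, show T |x| = 0 from hx, smul_zero])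

theorem mem_absKer {T : X →L[ℝ] X} {hT : IsPositiveOp T} {x : X} :
    x ∈ absKer T hT ↔ T |x| = 0 :=
  Iff.rfl

theorem isLatticeIdeal_absKer {T : X →L[ℝ] X} (hT : IsPositiveOp T) :
    IsLatticeIdeal (absKer T hT) :=
  fun _ hx _ hy => hT.apply_abs_eq_zero_of_le hy hx

theorem isClosed_absKer {T : X →L[ℝ] X} (hT : IsPositiveOp T) :
    IsClosed (absKer T hT : Set X) := by
  have h : Continuous fun x : X => |x| := continuous_id.sup continuous_neg
  exact isClosed_eq (T.continuous.comp h) continuous_const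

theorem eq_zero_of_forall_apply_abs {T : X →L[ℝ] X} (hT : IsPositiveOp T)
    (h : ∀ x : X, T |x| = 0) : T = 0 := by
  ext x
  have := hT.abs_apply_le x
  rw [h x] at this
  exact le_antisymm ((le_abs_self _).trans this) (neg_nonpos.1 ((neg_le_abs _).trans this))

/-- Otherwise the common absolute kernel `N` of all `S * A` is an invariant closed ideal containing
each `T |x|`. As `T ≠ 0`, it is everything, so `S * A = 0` for all `A`. Then the absolute kernel of
`S` contains every range, hence is invariant, and being trivial it forces `T = 0` or `S = 0`. -/
theorem IsIdealIrreducible.exists_mul_mul_ne_zero {𝒮 : Subsemigroup (X →L[ℝ] X)}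
    (hpos : ∀ T ∈ 𝒮, IsPositiveOp T) (hirr : IsIdealIrreducible 𝒮) {S T : X →L[ℝ] X}
    (hS : S ∈ 𝒮) (hT : T ∈ 𝒮) (hS0 : S ≠ 0) (hT0 : T ≠ 0) : ∃ A ∈ 𝒮, S * A * T ≠ 0 := by
  by_contra! h
  have hall : ∀ A ∈ 𝒮, S * A = 0 := by
    set N : Submodule ℝ X := ⨅ A : 𝒮, absKer (S * A) ((hpos S hS).mul (hpos A A.2)) with hN
    have hmem : ∀ x, x ∈ N ↔ ∀ A ∈ 𝒮, (S * A) |x| = 0 := by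
      intro x
      simp [hN, Submodule.mem_iInf, mem_absKer]
    have hpSA : ∀ A ∈ 𝒮, IsPositiveOp (S * A) := fun A hA => (hpos S hS).mul (hpos A hA)
    have hN_triv : N = ⊥ ∨ N = ⊤ := by
      refine hirr N ?_ ?_ ?_
      · intro x hx y hy
        exact (hmem y).2 fun A hA => (hpSA A hA).apply_abs_eq_zero_of_le hy ((hmem x).1 hx A hA)
      · rw [hN, Submodule.coe_iInf]
        exact isClosed_iInter fun A => isClosed_absKer _
      · intro B hB x hx
        exact (hmem _).2 fun A hA => (hpSA A hA).apply_abs_eq_zero_of_le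
          ((hpos B hB).abs_apply_le x) ((hmem x).1 hx (A * B) (𝒮.mul_mem hA hB))
    rcases hN_triv with hbot | htop
    · refine absurd (eq_zero_of_forall_apply_abs (hpos T hT) fun x => ?_) hT0
      have : T |x| ∈ N := (hmem _).2 fun A hA => by
        rw [abs_of_nonneg (hpos T hT _ (abs_nonneg x))]
        exact congrArg (fun B : X →L[ℝ] X => B |x|) (h A hA)
      rwa [hbot, Submodule.mem_bot] at this
    · exact fun A hA => eq_zero_of_forall_apply_abs (hpSA A hA) fun x =>
        (hmem x).1 (htop ▸ Submodule.mem_top) A hA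
  have hmem : ∀ A ∈ 𝒮, ∀ x, A x ∈ absKer S (hpos S hS) := fun A hA x =>
    (hpos S hS).apply_abs_eq_zero_of_le ((hpos A hA).abs_apply_le x)
      (congrArg (fun B : X →L[ℝ] X => B |x|) (hall A hA))
  rcases hirr _ (isLatticeIdeal_absKer (hpos S hS)) (isClosed_absKer (hpos S hS))
    (fun A hA x _ => hmem A hA x) with hbot | htop
  · refine hT0 (ContinuousLinearMap.ext fun x => ?_)
    have := hmem T hT x
    rwa [hbot, Submodule.mem_bot] at this
  · exact hS0 (eq_zero_of_forall_apply_abs (hpos S hS) fun x =>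
      mem_absKer.1 (htop ▸ Submodule.mem_top))

theorem exists_projections_of_opRank_eq {𝒮 : Subsemigroup (X →L[ℝ] X)}
    (hpos : ∀ T ∈ 𝒮, IsPositiveOp T) (hclosed : IsRPlusClosed 𝒮) (hirr : IsIdealIrreducible 𝒮)
    {r : ℕ} (hr : minrank 𝒮 = r) {S : X →L[ℝ] X} (hS : S ∈ 𝒮) (hS0 : S ≠ 0)
    (hSr : opRank S = r) :
    ∃ P ∈ rankProjections 𝒮 r, ∃ Q ∈ rankProjections 𝒮 r, P * S = S ∧ S * Q = S := by
  obtain ⟨A, hA, hSAS⟩ := hirr.exists_mul_mul_ne_zero hpos hS hS hS0 hS0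
  have hSA : S * A ∈ 𝒮 := 𝒮.mul_mem hS hA
  have hAS : A * S ∈ 𝒮 := 𝒮.mul_mem hA hS
  have hSAS_mem : S * A * S ∈ 𝒮 := 𝒮.mul_mem hSA hS
  have hSA0 : S * A ≠ 0 := fun h => hSAS (by rw [h, zero_mul])
  have hAS0 : A * S ≠ 0 := fun h => hSAS (by rw [mul_assoc, h, mul_zero])
  have hSAr : opRank (S * A) = r :=
    le_antisymm (hSr ▸ opRank_mul_le_left S A) (le_opRank hr hSA hSA0)
  have hASr : opRank (A * S) = r :=
    le_antisymm (hSr ▸ opRank_mul_le_right A S) (le_opRank hr hAS hAS0)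
  have hSASr : opRank (S * A * S) = r :=
    le_antisymm (hSr ▸ opRank_mul_le_right (S * A) S) (le_opRank hr hSAS_mem hSAS)
  have hfin := finiteDimensional_range_of_opRank_eq hSr
  have hrange₁ := range_eq_of_range_le hSAr hSr (range_mul_le S A)
  have hrange₂ := range_eq_of_range_le hSASr hSr (mul_assoc S A S ▸ range_mul_le S (A * S))
  -- `S * A` acts bijectively on the range of `S`.
  have hinj : ∀ v ∈ LinearMap.range (S : X →ₗ[ℝ] X), (S * A) v = 0 → v = 0 := by
    set f : LinearMap.range (S : X →ₗ[ℝ] X) →ₗ[ℝ] LinearMap.range (S : X →ₗ[ℝ] X) :=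
      ((S * A : X →L[ℝ] X) : X →ₗ[ℝ] X).restrict (fun v _ => ⟨A v, rfl⟩)
    have hsurj : Function.Surjective f := by
      rintro ⟨v, hv⟩
      rw [← hrange₂] at hv
      obtain ⟨x, rfl⟩ := hv
      exact ⟨⟨S x, x, rfl⟩, rfl⟩
    intro v hv h
    have := LinearMap.injective_iff_surjective.2 hsurj (a₁ := ⟨v, hv⟩) (a₂ := 0)
      (by rw [map_zero]; exact Subtype.ext h)
    exact congrArg Subtype.val this
  have hSASAS : S * A * (S * A * S) ≠ 0 := by
    intro h
    refine hSAS (ContinuousLinearMap.ext fun x => hinj _ ⟨A (S x), rfl⟩ ?_)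
    exact congrArg (fun B : X →L[ℝ] X => B x) h
  obtain ⟨P, hP, hPT, -⟩ := exists_projection_of_mul_self_ne_zero hclosed hr hSA hSAr
    (fun h => hSASAS (by rw [← mul_assoc, h, zero_mul]))
  obtain ⟨Q, hQ, -, hTQ⟩ := exists_projection_of_mul_self_ne_zero hclosed hr hAS hASr
    (fun h => hSASAS (by
      rw [show S * A * (S * A * S) = S * (A * S * (A * S)) by simp only [mul_assoc], h, mul_zero]))
  refine ⟨P, hP, Q, hQ, ContinuousLinearMap.ext fun x => ?_, ContinuousLinearMap.ext fun x => ?_⟩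
  · have hx : S x ∈ LinearMap.range ((S * A : X →L[ℝ] X) : X →ₗ[ℝ] X) := hrange₁ ▸ ⟨x, rfl⟩
    obtain ⟨y, hy⟩ := hx
    have hy' : (S * A) y = S x := hy
    change P (S x) = S x
    rw [← hy']
    exact congrArg (fun B : X →L[ℝ] X => B y) hPT
  · have hx : A (S (Q x)) = A (S x) := congrArg (fun B : X →L[ℝ] X => B x) hTQ
    -- `A * S * Q = A * S` only gives equality after `A`; injectivity of `S * A` on the range of `S`
    -- removes it.
    refine sub_eq_zero.1 (hinj (S (Q x) - S x) ⟨Q x - x, map_sub S _ _⟩ ?_)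
    change S (A (S (Q x) - S x)) = 0
    rw [map_sub A, hx, sub_self, map_zero]

end Irreducible

end OperatorSemigroup

theorem mainTheorem5 {X : Type*} [NormedAddCommGroup X] [NormedSpace ℝ X] [Lattice X]
    [BanachLattice X] (𝒮 : Subsemigroup (X →L[ℝ] X))
    (hpos : ∀ T ∈ 𝒮, OperatorSemigroup.IsPositiveOp T)
    (hclosed : OperatorSemigroup.IsRPlusClosed 𝒮)
    (hirr : OperatorSemigroup.IsIdealIrreducible 𝒮)
    (r : ℕ) (hr : OperatorSemigroup.minrank 𝒮 = r) :
    ∀ S ∈ OperatorSemigroup.rankPart 𝒮 r,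
      ∃ P ∈ OperatorSemigroup.rankProjections 𝒮 r,
        ∃ Q ∈ OperatorSemigroup.rankProjections 𝒮 r, P * S = S ∧ S * Q = S := by
  rintro S ⟨hS, hSr⟩
  by_cases hS0 : S = 0
  -- For `S = 0` any rank `r` projections work; a minimal-rank `T` supplies them.
  · obtain ⟨T, hT, hT0, hTr⟩ := OperatorSemigroup.exists_opRank_eq hr
    obtain ⟨P, hP, Q, hQ, -⟩ :=
      OperatorSemigroup.exists_projections_of_opRank_eq hpos hclosed hirr hr hT hT0 hTr
    exact ⟨P, hP, Q, hQ, by rw [hS0, mul_zero], by rw [hS0, zero_mul]⟩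
  · exact OperatorSemigroup.exists_projections_of_opRank_eq hpos hclosed hirr hr hS hS0
      (hSr.resolve_right hS0)
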